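/- Let $\mathbb{K}\in\{\mathbb{R},\mathbb{C}\}$ and $1\le p\le\infty$, and let $\|\cdot\|_p$ be the Schatten $p$-norm (the $\ell_p$ norm of the singular values; the spectral norm for $p=\infty$), with $1/\infty=0$. Let $\{1,\dots,n\}$ be partitioned into $n_t$ consecutive nonempty blocks, let $n_b$ be the largest block size, and write $B_{i,j}$ for the $(i,j)$ block of a matrix $B\in\mathbb{K}^{n\times n}$ and $\|B\|_{\max p}=\max_{i,j}\|B_{i,j}\|_p$. For $A\in\mathbb{K}^{n\times n}$ let $A^{(1)}=A$ and, for $2\le k\le n_t$, let $$A^{(k)}=A_{k:n_t,\,k:n_t}-A_{k:n_t,\,1:k-1}\,(A_{1:k-1,\,1:k-1})^{-1}A_{1:k-1,\,k:n_t}$$ be the successive block Schur complements (subscripts refer to blocks, and the blocks of $A^{(k)}$ are numbered from $k$ to $n_t$). Define the growth factors $$\rho_{p}=\frac{\max_{1\le k\le n_t}\|A^{(k)}\|_{p}}{\|A\|_{p}},\qquad \rho_{\max p}=\frac{\max_{1\le k\le n_t}\|A^{(k)}\|_{\max p}}{\|A\|_{\max p}} .$$ Suppose that $A$ is strongly nonsingular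 (all its leading principal submatrices are nonsingular), and let $A=LR$ be a block LU factorization, i.e. $L$ is block lower triangular and $R$ is block upper triangular, in which the diagonal blocks of $L$ are unitary. Assume that $\bigl\|A^{(k)}_{i,k}\bigl(A^{(k)}_{k,k}\bigr)^{-1}\bigr\|_p\le 1$ for all $1\le k<i\le n_t$. Then $$\|L\|_{\max p}\le n_b^{1/p}\qquad\text{and}\qquad \|L\|_p\le n_b^{1/p}\,n_t^2 .$$ Consequently, $$\|L\|_{\max p}\,\|R\|_{\max p}\le n_b^{1/p}\,\rho_{\max p}\,\|A\|_{\max p}\qquad\text{and}\qquad \|L\|_p\,\|R\|_p\le n_b^{1/p}\,n_t^3\,\rho_p\,\|A\|_p .$$ -/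

import Mathlib

open scoped ENNReal

noncomputable section

namespace BlockLU

/-- The Schatten `p`-norm (`1 ≤ p ≤ ∞`): the `ℓ_p` norm of the sequence of singular values
`σ₀ ≥ σ₁ ≥ …`; for `p = ∞` it is the largest singular value, i.e. the spectral norm. -/
def schattenNorm {𝕜 ι κ : Type*} [RCLike 𝕜] [Fintype ι] [DecidableEq ι] [Fintype κ]
    [DecidableEq κ] (p : ℝ≥0∞) (M : Matrix ι κ 𝕜) : ℝ :=
  if p = ∞ then (Matrix.toEuclideanLin M).singularValues 0
  else (∑ i ∈ Finset.range (Fintype.card κ),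
    (Matrix.toEuclideanLin M).singularValues i ^ p.toReal) ^ (1 / p.toReal)

/-- The `(i, j)` block of a square matrix `B` whose row and column indices `x` carry the block
labels `b x`. -/
def block {𝕜 ι : Type*} {t : ℕ} (b : ι → Fin t) (B : Matrix ι ι 𝕜) (i j : Fin t) :
    Matrix {x // b x = i} {x // b x = j} 𝕜 :=
  B.toBlock (fun x => b x = i) (fun x => b x = j)

/-- The block-max norm `‖B‖_{max p}`: the largest Schatten `p`-norm of a block of `B`
(labels that do not occur give empty blocks, which have norm `0`). -/
def blockMaxNorm {𝕜 ι : Type*} [RCLike 𝕜] [Fintype ι] [DecidableEq ι] {t : ℕ} (p : ℝ≥0∞)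
    (b : ι → Fin t) (B : Matrix ι ι 𝕜) : ℝ :=
  ⨆ ij : Fin t × Fin t, schattenNorm p (block b B ij.1 ij.2)

/-- All leading principal submatrices are nonsingular. -/
def StronglyNonsingular {𝕜 : Type*} [RCLike 𝕜] {n : ℕ} (A : Matrix (Fin n) (Fin n) 𝕜) : Prop :=
  ∀ (k : ℕ) (hk : k ≤ n), IsUnit (A.submatrix (Fin.castLE hk) (Fin.castLE hk)).det

/-! A partition of `{0, …, n-1}` into consecutive nonempty blocks is a `c : Composition n`;
there are `c.length` blocks, and `c.index x` is the number of the block containing `x`. -/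

/-- The largest block size `n_b`. -/
def maxBlockSize {n : ℕ} (c : Composition n) : ℕ :=
  Finset.univ.sup c.blocksFun

/-- `A = L R` is a block LU factorization with respect to the partition `c`: `L` is block lower
triangular and `R` is block upper triangular. -/
structure IsBlockLU {𝕜 : Type*} [RCLike 𝕜] {n : ℕ} (c : Composition n)
    (A L R : Matrix (Fin n) (Fin n) 𝕜) : Prop where
  lower : ∀ x y, c.index x < c.index y → L x y = 0
  upper : ∀ x y, c.index y < c.index x → R x y = 0
  eq_mul : A = L * R

/-- The indices in blocks `k, k+1, …`. -/
abbrev Trailing {n : ℕ} (c : Composition n) (k : Fin c.length) : Type :=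
  {x : Fin n // k ≤ c.index x}

/-- The block labels of the trailing indices (the numbering of the blocks is kept). -/
def trailingIndex {n : ℕ} (c : Composition n) (k : Fin c.length) (x : Trailing c k) :
    Fin c.length :=
  c.index x.1

/-- The Schur complement `A^{(k)}` that is left when the blocks before block `k` have been
eliminated. -/
def schur {𝕜 : Type*} [RCLike 𝕜] {n : ℕ} (c : Composition n) (A : Matrix (Fin n) (Fin n) 𝕜)
    (k : Fin c.length) : Matrix (Trailing c k) (Trailing c k) 𝕜 :=
  A.toBlock (fun x => k ≤ c.index x) (fun x => k ≤ c.index x) -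
    A.toBlock (fun x => k ≤ c.index x) (fun x => c.index x < k) *
      (A.toBlock (fun x => c.index x < k) (fun x => c.index x < k))⁻¹ *
      A.toBlock (fun x => c.index x < k) (fun x => k ≤ c.index x)

/-- The block `A^{(k)}_{i,j}` (meant for `k ≤ i` and `k ≤ j`). -/
def schurBlock {𝕜 : Type*} [RCLike 𝕜] {n : ℕ} (c : Composition n)
    (A : Matrix (Fin n) (Fin n) 𝕜) (k i j : Fin c.length) :
    Matrix {x // trailingIndex c k x = i} {x // trailingIndex c k x = j} 𝕜 :=
  block (trailingIndex c k) (schur c A k) i j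

/-- The growth factor `ρ_p = max_k ‖A^{(k)}‖_p / ‖A‖_p`. -/
def growth {𝕜 : Type*} [RCLike 𝕜] {n : ℕ} (p : ℝ≥0∞) (c : Composition n)
    (A : Matrix (Fin n) (Fin n) 𝕜) : ℝ :=
  (⨆ k : Fin c.length, schattenNorm p (schur c A k)) / schattenNorm p A

/-- The growth factor `ρ_{max p} = max_k ‖A^{(k)}‖_{max p} / ‖A‖_{max p}`. -/
def growthMax {𝕜 : Type*} [RCLike 𝕜] {n : ℕ} (p : ℝ≥0∞) (c : Composition n)
    (A : Matrix (Fin n) (Fin n) 𝕜) : ℝ :=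
  (⨆ k : Fin c.length, blockMaxNorm p (trailingIndex c k) (schur c A k)) /
    blockMaxNorm p c.index A

end BlockLU

end

/-! Triangularity of `L` and `R` gives A^{(k)} = L_{k:,k:} R_{k:,k:} (`IsBlockLU.schur_eq`). Its
first block column and row read A^{(k)}_{i,k} = L_{i,k} R_{k,k} and A^{(k)}_{k,j} = L_{k,k} R_{k,j}.
Hence L_{i,k} = A^{(k)}_{i,k} (A^{(k)}_{k,k})⁻¹ L_{k,k} and R_{k,j} = L_{k,k}^* A^{(k)}_{k,j}.
Unitary factors do not increase the Schatten norm, so blocks of `L` below the diagonal have norm at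
most 1, the diagonal ones at most n_b^{1/p}, and blocks of `R` are bounded by those of the Schur
complements. For the full norms, the triangle inequality over the n_t² blocks of `L` and the n_t
block rows of `R` produces n_t² and n_t³.

The Schatten norm facts needed (triangle inequality, monotonicity under contractions and
submatrices) all follow from one variational principle: ‖M‖_p is the maximum of the ℓ_p norms of the
sequences ⟨u_i, M v_i⟩ over Bessel families u, v (`norm_toLp_inner_le_schattenNorm`,
`exists_schattenNorm_eq`). Bessel families replace orthonormal ones because they survive
contractions and may contain zeros. -/

namespace BlockLU

/-! ### Bessel families, singular value decomposition and the variational bound -/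

section Bessel

variable {𝕜 E F : Type*} [RCLike 𝕜] [NormedAddCommGroup E] [InnerProductSpace 𝕜 E]
  [NormedAddCommGroup F] [InnerProductSpace 𝕜 F]

/-- A finite family satisfying Bessel's inequality. -/
def IsBessel (𝕜 : Type*) {E I : Type*} [RCLike 𝕜] [NormedAddCommGroup E] [InnerProductSpace 𝕜 E]
    [Fintype I] (u : I → E) : Prop :=
  ∀ x, ∑ i, ‖inner 𝕜 (u i) x‖ ^ 2 ≤ ‖x‖ ^ 2

theorem IsBessel.norm_sq_le_one {I : Type*} [Fintype I] {u : I → E} (hu : IsBessel 𝕜 u) (i : I) :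
    ‖u i‖ ^ 2 ≤ 1 := by
  have h1 : ‖inner 𝕜 (u i) (u i)‖ ^ 2 ≤ ‖u i‖ ^ 2 :=
    (Finset.single_le_sum (f := fun j => ‖inner 𝕜 (u j) (u i)‖ ^ 2) (fun _ _ => by positivity)
      (Finset.mem_univ i)).trans (hu (u i))
  have h2 : ‖inner 𝕜 (u i) (u i)‖ = ‖u i‖ ^ 2 := by
    rw [inner_self_eq_norm_sq_to_K]; simp
  -- Bessel's inequality at x = u_i reads ‖u_i‖⁴ ≤ ‖u_i‖².
  rw [h2] at h1
  by_contra h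
  nlinarith

theorem IsBessel.map [FiniteDimensional 𝕜 E] [FiniteDimensional 𝕜 F] {I : Type*} [Fintype I]
    {u : I → E} (hu : IsBessel 𝕜 u) (T : E →ₗ[𝕜] F) (hT : ∀ x, ‖T.adjoint x‖ ≤ ‖x‖) :
    IsBessel 𝕜 (fun i => T (u i)) := by
  intro x
  simp_rw [← LinearMap.adjoint_inner_right]
  exact (hu _).trans (pow_le_pow_left₀ (norm_nonneg _) (hT x) 2)

theorem isBessel_orthonormalBasis {I : Type*} [Fintype I] (e : OrthonormalBasis I 𝕜 E) :
    IsBessel 𝕜 e := fun x => (e.sum_sq_norm_inner_right x).le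

theorem isBessel_of_orthonormal_restrict {I : Type*} [Fintype I] {f : I → E} {P : I → Prop}
    (h0 : ∀ i, ¬ P i → f i = 0) (hf : Orthonormal 𝕜 (fun i : {i // P i} => f i)) :
    IsBessel 𝕜 f := by
  classical
  intro x
  have h := hf.sum_inner_products_le (s := Finset.univ) x
  rw [← Finset.sum_subtype (Finset.univ.filter P) (by simp)
    (fun i => ‖inner 𝕜 (f i) x‖ ^ 2)] at h
  rw [Finset.sum_filter_of_ne] at h
  · exact h
  · intro i _ hi
    by_contra hP
    simp [h0 i hP] at hi

/-- Take e_j an eigenbasis of T^*T and f_j = σ_j⁻¹ T e_j. When σ_j = 0 the convention 0⁻¹ = 0 makes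
f_j = 0, so f is orthonormal only on the nonzero singular values, but Bessel throughout. -/
theorem exists_singular_value_decomposition [FiniteDimensional 𝕜 E] [FiniteDimensional 𝕜 F]
    (T : E →ₗ[𝕜] F) {n : ℕ} (hn : Module.finrank 𝕜 E = n) :
    ∃ (e : Fin n → E) (f : Fin n → F), IsBessel 𝕜 e ∧ IsBessel 𝕜 f ∧
      (∀ x, T x = ∑ j : Fin n, (T.singularValues j : 𝕜) • inner 𝕜 (e j) x • f j) ∧
      ∀ j : Fin n, inner 𝕜 (f j) (T (e j)) = (T.singularValues j : 𝕜) := by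
  set e := T.isSymmetric_adjoint_comp_self.eigenvectorBasis hn with he
  have hTe : ∀ i j, inner 𝕜 (T (e i)) (T (e j)) =
      if i = j then (T.singularValues j : 𝕜) ^ 2 else 0 := by
    intro i j
    rw [← LinearMap.adjoint_inner_right]
    have := T.isSymmetric_adjoint_comp_self.apply_eigenvectorBasis hn j
    rw [LinearMap.comp_apply] at this
    rw [he, this, inner_smul_right, orthonormal_iff_ite.mp (OrthonormalBasis.orthonormal _),
      ← T.sq_singularValues_fin hn]
    split_ifs <;> simp
  have hz : ∀ j : Fin n, T.singularValues j = 0 → T (e j) = 0 := by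
    intro j hj
    have := hTe j j
    rw [if_pos rfl, hj] at this
    exact inner_self_eq_zero.mp (this.trans (by simp))
  have hf : ∀ j : Fin n, T (e j) =
      (T.singularValues j : 𝕜) • ((T.singularValues j : 𝕜)⁻¹ • T (e j)) := by
    intro j
    by_cases hj : T.singularValues j = 0
    · simp [hz j hj]
    · rw [smul_smul, mul_inv_cancel₀ (by exact_mod_cast hj), one_smul]
  refine ⟨e, fun j => (T.singularValues j : 𝕜)⁻¹ • T (e j), isBessel_orthonormalBasis e,
    isBessel_of_orthonormal_restrict (P := fun j => T.singularValues j ≠ 0) ?_ ?_, ?_, ?_⟩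
  · intro i hi
    simp only [not_not] at hi
    simp [hi]
  · rw [orthonormal_iff_ite]
    rintro ⟨i, hi⟩ ⟨j, hj⟩
    have hi' : (T.singularValues i : 𝕜) ≠ 0 := by exact_mod_cast hi
    simp only [inner_smul_left, inner_smul_right, hTe, Subtype.mk.injEq]
    split_ifs with h
    · subst h
      simp only [map_inv₀, RCLike.conj_ofReal]
      field_simp
    · simp
  · intro x
    conv_lhs => rw [← e.sum_repr' x]
    rw [map_sum]
    refine Finset.sum_congr rfl fun j _ => ?_
    rw [map_smul, smul_comm, ← hf]
  · intro j
    by_cases hj : (T.singularValues j : 𝕜) = 0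
    · simp [hj]
    · rw [inner_smul_left, hTe, if_pos rfl, map_inv₀, RCLike.conj_ofReal]
      field_simp

/-- For finite p, the weighted power mean inequality in each row gives |a_i|^p ≤ ∑_j w_ij |s_j|^p;
summing over i uses the column sums. For p = ∞ the row sums suffice. -/
theorem norm_toLp_le_of_substochastic {𝕜' 𝕜'' : Type*} [NormedAddCommGroup 𝕜']
    [NormedAddCommGroup 𝕜''] {I J : Type*} [Fintype I] [Fintype J]
    (p : ℝ≥0∞) [Fact (1 ≤ p)] (a : I → 𝕜') (s : J → 𝕜'') (w : I → J → ℝ) (hw : ∀ i j, 0 ≤ w i j)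
    (hrow : ∀ i, ∑ j, w i j ≤ 1) (hcol : ∀ j, ∑ i, w i j ≤ 1)
    (ha : ∀ i, ‖a i‖ ≤ ∑ j, w i j * ‖s j‖) :
    ‖WithLp.toLp p a‖ ≤ ‖WithLp.toLp p s‖ := by
  by_cases hp : p = ∞
  · subst hp
    rw [PiLp.norm_eq_ciSup]
    refine Real.iSup_le (fun i => ?_) (norm_nonneg _)
    calc ‖a i‖ ≤ ∑ j, w i j * ‖s j‖ := ha i
      _ ≤ ∑ j, w i j * ‖WithLp.toLp ∞ s‖ := by
          gcongr with j
          · exact hw i j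
          · exact PiLp.norm_apply_le (WithLp.toLp ∞ s) j
      _ = (∑ j, w i j) * ‖WithLp.toLp ∞ s‖ := by rw [Finset.sum_mul]
      _ ≤ 1 * ‖WithLp.toLp ∞ s‖ := by gcongr; exact hrow i
      _ = _ := one_mul _
  · have hp1 : 1 ≤ p.toReal := by
      have := (ENNReal.toReal_le_toReal ENNReal.one_ne_top hp).mpr (Fact.out : 1 ≤ p)
      simpa using this
    have hp0 : 0 < p.toReal := by linarith
    rw [PiLp.norm_eq_sum hp0, PiLp.norm_eq_sum hp0]
    refine Real.rpow_le_rpow (Finset.sum_nonneg fun _ _ => by positivity) ?_ (by positivity)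
    calc ∑ i, ‖a i‖ ^ p.toReal ≤ ∑ i, ∑ j, w i j * ‖s j‖ ^ p.toReal := by
          refine Finset.sum_le_sum fun i _ => ?_
          have h0 : 0 ≤ ∑ j, w i j * ‖s j‖ ^ p.toReal :=
            Finset.sum_nonneg fun j _ => mul_nonneg (hw i j) (by positivity)
          have h1 := Real.inner_le_weight_mul_Lp_of_nonneg Finset.univ hp1 (w i) (fun j => ‖s j‖)
            (hw i) (fun _ => norm_nonneg _)
          have h2 : (∑ j, w i j) ^ (1 - p.toReal⁻¹) ≤ 1 :=
            Real.rpow_le_one (Finset.sum_nonneg fun j _ => hw i j) (hrow i)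
              (by rw [sub_nonneg]; exact inv_le_one_of_one_le₀ hp1)
          have h3 : ‖a i‖ ≤ (∑ j, w i j * ‖s j‖ ^ p.toReal) ^ (p.toReal⁻¹) :=
            (ha i).trans (h1.trans (mul_le_of_le_one_left (Real.rpow_nonneg h0 _) h2))
          calc ‖a i‖ ^ p.toReal ≤ ((∑ j, w i j * ‖s j‖ ^ p.toReal) ^ (p.toReal⁻¹)) ^ p.toReal :=
                Real.rpow_le_rpow (norm_nonneg _) h3 hp0.le
            _ = _ := Real.rpow_inv_rpow h0 hp0.ne'
      _ = ∑ j, (∑ i, w i j) * ‖s j‖ ^ p.toReal := by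
          rw [Finset.sum_comm]; simp_rw [Finset.sum_mul]
      _ ≤ ∑ j, ‖s j‖ ^ p.toReal := by
          gcongr with j
          exact mul_le_of_le_one_left (by positivity) (hcol j)

/-- Inserting the decomposition gives ⟨u_i, T v_i⟩ = ∑_j σ_j ⟨e_j, v_i⟩ ⟨u_i, f_j⟩. By the
arithmetic-geometric mean inequality the coefficients are dominated by averaged squares, whose row
and column sums are at most 1 because all four families are Bessel. -/
theorem norm_toLp_inner_le [FiniteDimensional 𝕜 E] [FiniteDimensional 𝕜 F]
    (p : ℝ≥0∞) [Fact (1 ≤ p)] (T : E →ₗ[𝕜] F) {n : ℕ} (hn : Module.finrank 𝕜 E = n)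
    {I : Type*} [Fintype I] {u : I → F} {v : I → E} (hu : IsBessel 𝕜 u) (hv : IsBessel 𝕜 v) :
    ‖WithLp.toLp p (fun i => inner 𝕜 (u i) (T (v i)))‖ ≤
      ‖WithLp.toLp p (fun j : Fin n => T.singularValues j)‖ := by
  obtain ⟨e, f, he, hf, hT, -⟩ := exists_singular_value_decomposition T hn
  refine norm_toLp_le_of_substochastic p _ _
    (fun i j => (‖inner 𝕜 (u i) (f j)‖ ^ 2 + ‖inner 𝕜 (e j) (v i)‖ ^ 2) / 2)
    (fun _ _ => by positivity) ?_ ?_ ?_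
  · intro i
    have h1 := hf (u i)
    have h2 := he (v i)
    simp_rw [norm_inner_symm (f _)] at h1
    rw [← Finset.sum_div, Finset.sum_add_distrib]
    linarith [hu.norm_sq_le_one i, hv.norm_sq_le_one i]
  · intro j
    have h1 := hu (f j)
    have h2 := hv (e j)
    simp_rw [norm_inner_symm (v _)] at h2
    rw [← Finset.sum_div, Finset.sum_add_distrib]
    linarith [hf.norm_sq_le_one j, he.norm_sq_le_one j]
  · intro i
    rw [hT, inner_sum]
    refine (norm_sum_le _ _).trans (Finset.sum_le_sum fun j _ => ?_)
    rw [inner_smul_right, inner_smul_right, norm_mul, norm_mul, RCLike.norm_ofReal,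
      Real.norm_eq_abs, mul_comm]
    gcongr
    nlinarith [sq_nonneg (‖inner 𝕜 (u i) (f j)‖ - ‖inner 𝕜 (e j) (v i)‖)]

end Bessel

/-! ### Schatten norms: norm properties and contractions -/

section Schatten

variable {𝕜 ι κ : Type*} [RCLike 𝕜] [Fintype ι] [DecidableEq ι] [Fintype κ] [DecidableEq κ]

theorem schattenNorm_eq_norm_toLp (p : ℝ≥0∞) (hp : 1 ≤ p) (M : Matrix ι κ 𝕜) :
    schattenNorm p M = ‖WithLp.toLp p
      (fun j : Fin (Fintype.card κ) => (Matrix.toEuclideanLin M).singularValues j)‖ := by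
  have : Fact (1 ≤ p) := ⟨hp⟩
  unfold schattenNorm
  split_ifs with h
  · subst h
    set T := Matrix.toEuclideanLin M
    rw [PiLp.norm_eq_ciSup]
    apply le_antisymm
    · by_cases hc : Fintype.card κ = 0
      · rw [T.singularValues_of_finrank_le (by simp [hc])]
        exact Real.iSup_nonneg fun _ => norm_nonneg _
      · refine (le_abs_self _).trans
          (le_ciSup (f := fun j : Fin (Fintype.card κ) => ‖T.singularValues j‖)
            (Set.finite_range _).bddAbove ⟨0, Nat.pos_of_ne_zero hc⟩)
    · refine Real.iSup_le (fun j => ?_) (T.singularValues_nonneg 0)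
      rw [Real.norm_of_nonneg (T.singularValues_nonneg _)]
      exact T.singularValues_antitone (Nat.zero_le _)
  · rw [PiLp.norm_eq_sum (ENNReal.toReal_pos (by positivity) h), Finset.sum_range]
    simp only [Real.norm_of_nonneg (LinearMap.singularValues_nonneg _ _)]

theorem schattenNorm_nonneg (p : ℝ≥0∞) (hp : 1 ≤ p) (M : Matrix ι κ 𝕜) : 0 ≤ schattenNorm p M := by
  have : Fact (1 ≤ p) := ⟨hp⟩
  rw [schattenNorm_eq_norm_toLp p hp]
  exact norm_nonneg _

theorem norm_toLp_inner_le_schattenNorm (p : ℝ≥0∞) [hp : Fact (1 ≤ p)] (M : Matrix ι κ 𝕜)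
    {I : Type*} [Fintype I] {u : I → EuclideanSpace 𝕜 ι} {v : I → EuclideanSpace 𝕜 κ}
    (hu : IsBessel 𝕜 u) (hv : IsBessel 𝕜 v) :
    ‖WithLp.toLp p (fun i => inner 𝕜 (u i) (Matrix.toEuclideanLin M (v i)))‖ ≤
      schattenNorm p M := by
  rw [schattenNorm_eq_norm_toLp p hp.out]
  exact norm_toLp_inner_le p _ (by simp) hu hv

theorem exists_schattenNorm_eq (p : ℝ≥0∞) [hp : Fact (1 ≤ p)] (M : Matrix ι κ 𝕜) :
    ∃ (u : Fin (Fintype.card κ) → EuclideanSpace 𝕜 ι) (v : Fin (Fintype.card κ) →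
      EuclideanSpace 𝕜 κ), IsBessel 𝕜 u ∧ IsBessel 𝕜 v ∧ schattenNorm p M =
        ‖WithLp.toLp p (fun i => inner 𝕜 (u i) (Matrix.toEuclideanLin M (v i)))‖ := by
  obtain ⟨e, f, he, hf, -, h⟩ := exists_singular_value_decomposition (Matrix.toEuclideanLin M)
    (n := Fintype.card κ) (by simp)
  refine ⟨f, e, hf, he, ?_⟩
  rw [schattenNorm_eq_norm_toLp p hp.out]
  simp_rw [h]
  by_cases hp' : p = ∞
  · subst hp'
    simp [PiLp.norm_eq_ciSup]
  · have := ENNReal.toReal_pos (zero_lt_one.trans_le hp.out).ne' hp'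
    simp [PiLp.norm_eq_sum this]

theorem schattenNorm_zero (p : ℝ≥0∞) (hp : 1 ≤ p) : schattenNorm p (0 : Matrix ι κ 𝕜) = 0 := by
  have : Fact (1 ≤ p) := ⟨hp⟩
  rw [schattenNorm_eq_norm_toLp p hp]
  simp only [map_zero, LinearMap.singularValues_zero, Finsupp.coe_zero, Pi.zero_apply]
  exact norm_zero

theorem eq_zero_of_schattenNorm_eq_zero (p : ℝ≥0∞) (hp : 1 ≤ p) {M : Matrix ι κ 𝕜}
    (h : schattenNorm p M = 0) : M = 0 := by
  have : Fact (1 ≤ p) := ⟨hp⟩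
  rw [schattenNorm_eq_norm_toLp p hp, norm_eq_zero] at h
  rw [← map_eq_zero_iff _ (Matrix.toEuclideanLin (𝕜 := 𝕜) (m := ι) (n := κ)).injective,
    ← LinearMap.singularValues_eq_zero_iff]
  ext j
  by_cases hj : j < Fintype.card κ
  · exact congrFun (congrArg WithLp.ofLp h) ⟨j, hj⟩
  · exact LinearMap.singularValues_of_finrank_le _ (by simpa using hj)

theorem schattenNorm_add_le (p : ℝ≥0∞) (hp : 1 ≤ p) (M N : Matrix ι κ 𝕜) :
    schattenNorm p (M + N) ≤ schattenNorm p M + schattenNorm p N := by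
  have : Fact (1 ≤ p) := ⟨hp⟩
  obtain ⟨u, v, hu, hv, h⟩ := exists_schattenNorm_eq p (M + N)
  rw [h]
  simp only [map_add, LinearMap.add_apply, inner_add_right]
  exact (norm_add_le (WithLp.toLp p fun i => inner 𝕜 (u i) (Matrix.toEuclideanLin M (v i)))
    (WithLp.toLp p fun i => inner 𝕜 (u i) (Matrix.toEuclideanLin N (v i)))).trans
    (add_le_add (norm_toLp_inner_le_schattenNorm p M hu hv)
      (norm_toLp_inner_le_schattenNorm p N hu hv))

theorem schattenNorm_sum_le (p : ℝ≥0∞) (hp : 1 ≤ p) {I : Type*} (s : Finset I)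
    (M : I → Matrix ι κ 𝕜) :
    schattenNorm p (∑ i ∈ s, M i) ≤ ∑ i ∈ s, schattenNorm p (M i) :=
  Finset.le_sum_of_subadditive _ (schattenNorm_zero p hp).le (schattenNorm_add_le p hp) s M

/-- A matrix whose Euclidean operator norm is at most one. -/
def IsContraction (P : Matrix ι κ 𝕜) : Prop :=
  ∀ x, ‖Matrix.toEuclideanLin P x‖ ≤ ‖x‖

theorem IsContraction.conjTranspose {P : Matrix ι κ 𝕜} (hP : IsContraction P) :
    IsContraction P.conjTranspose := by
  intro x
  rw [Matrix.toEuclideanLin_conjTranspose_eq_adjoint]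
  set y := (Matrix.toEuclideanLin P).adjoint x
  -- With y = P^*x, ‖y‖² = ⟨x, P y⟩ ≤ ‖x‖ ‖y‖.
  have h : ‖y‖ * ‖y‖ ≤ ‖x‖ * ‖y‖ := by
    have h1 : inner 𝕜 y y = inner 𝕜 x (Matrix.toEuclideanLin P y) :=
      LinearMap.adjoint_inner_left _ _ _
    calc ‖y‖ * ‖y‖ = ‖inner 𝕜 y y‖ := by rw [inner_self_eq_norm_sq_to_K]; simp [sq]
      _ ≤ ‖x‖ * ‖Matrix.toEuclideanLin P y‖ := by rw [h1]; exact norm_inner_le_norm _ _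
      _ ≤ _ := by gcongr; exact hP y
  by_contra hlt
  push Not at hlt
  nlinarith [norm_nonneg x]

theorem isContraction_of_conjTranspose_mul_self {P : Matrix ι κ 𝕜} (h : P.conjTranspose * P = 1) :
    IsContraction P := by
  intro x
  refine le_of_eq ?_
  have h1 : inner 𝕜 (Matrix.toEuclideanLin P x) (Matrix.toEuclideanLin P x) = inner 𝕜 x x := by
    rw [← LinearMap.adjoint_inner_right, ← Matrix.toEuclideanLin_conjTranspose_eq_adjoint]
    simp only [Matrix.toLpLin_apply, Matrix.mulVec_mulVec, h, Matrix.one_mulVec]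
  rw [@norm_eq_sqrt_re_inner 𝕜, h1, ← @norm_eq_sqrt_re_inner 𝕜]

/-- Since ⟨u, P M Q v⟩ = ⟨P^*u, M Q v⟩, a Bessel pair optimal for P M Q is carried to a Bessel pair
for M. -/
theorem schattenNorm_mul_mul_le (p : ℝ≥0∞) (hp : 1 ≤ p) {ι' κ' : Type*} [Fintype ι']
    [DecidableEq ι'] [Fintype κ'] [DecidableEq κ'] {P : Matrix ι' ι 𝕜} (hP : IsContraction P)
    (M : Matrix ι κ 𝕜) {Q : Matrix κ κ' 𝕜} (hQ : IsContraction Q) :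
    schattenNorm p (P * M * Q) ≤ schattenNorm p M := by
  have : Fact (1 ≤ p) := ⟨hp⟩
  obtain ⟨u, v, hu, hv, h⟩ := exists_schattenNorm_eq p (P * M * Q)
  have hu' := hu.map (Matrix.toEuclideanLin P).adjoint
    (by rw [LinearMap.adjoint_adjoint]; exact hP)
  have hv' := hv.map (Matrix.toEuclideanLin Q)
    (by rw [← Matrix.toEuclideanLin_conjTranspose_eq_adjoint]; exact hQ.conjTranspose)
  refine h.trans_le ((le_of_eq ?_).trans (norm_toLp_inner_le_schattenNorm p M hu' hv'))
  congr 2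
  ext i
  rw [LinearMap.adjoint_inner_left]
  simp only [Matrix.toLpLin_apply, Matrix.mulVec_mulVec, Matrix.mul_assoc]

theorem isContraction_one : IsContraction (1 : Matrix ι ι 𝕜) :=
  isContraction_of_conjTranspose_mul_self (by simp)

theorem isContraction_unitary {U : Matrix ι ι 𝕜} (hU : U ∈ Matrix.unitaryGroup ι 𝕜) :
    IsContraction U :=
  isContraction_of_conjTranspose_mul_self (Matrix.mem_unitaryGroup_iff'.mp hU)

/-- The optimal sequence has `Fintype.card κ` entries, each of modulus at most 1. At p = ∞ the
exponent `(1 / p).toReal` is 0. -/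
theorem schattenNorm_le_of_isContraction (p : ℝ≥0∞) (hp : 1 ≤ p) {U : Matrix ι κ 𝕜}
    (hU : IsContraction U) :
    schattenNorm p U ≤ (Fintype.card κ : ℝ) ^ (1 / p).toReal := by
  have : Fact (1 ≤ p) := ⟨hp⟩
  obtain ⟨u, v, hu, hv, h⟩ := exists_schattenNorm_eq p U
  have hle : ∀ i, ‖inner 𝕜 (u i) (Matrix.toEuclideanLin U (v i))‖ ≤ 1 := by
    intro i
    have h1 := norm_inner_le_norm (𝕜 := 𝕜) (u i) (Matrix.toEuclideanLin U (v i))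
    have h2 := hU (v i)
    have h3 : ‖u i‖ ≤ 1 := by nlinarith [hu.norm_sq_le_one i, norm_nonneg (u i)]
    have h4 : ‖v i‖ ≤ 1 := by nlinarith [hv.norm_sq_le_one i, norm_nonneg (v i)]
    exact h1.trans (mul_le_one₀ h3 (norm_nonneg _) (h2.trans h4))
  rw [h]
  by_cases hp' : p = ∞
  · subst hp'
    rw [PiLp.norm_eq_ciSup]
    refine Real.iSup_le (fun i => ?_) (by positivity)
    simpa using hle i
  · have hp0 := ENNReal.toReal_pos (zero_lt_one.trans_le hp).ne' hp'
    rw [PiLp.norm_eq_sum hp0, one_div p, ENNReal.toReal_inv, ← one_div]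
    refine Real.rpow_le_rpow (Finset.sum_nonneg fun _ _ => by positivity) ?_ (by positivity)
    calc ∑ i, ‖inner 𝕜 (u i) (Matrix.toEuclideanLin U (v i))‖ ^ p.toReal
        ≤ ∑ _i : Fin (Fintype.card κ), (1 : ℝ) :=
          Finset.sum_le_sum fun i _ => Real.rpow_le_one (norm_nonneg _) (hle i) hp0.le
      _ = _ := by simp

end Schatten


/-! ### Submatrices and blocks via coordinate selections -/

section Selection

variable {𝕜 ι κ : Type*} [RCLike 𝕜] [Fintype ι] [DecidableEq ι] [Fintype κ] [DecidableEq κ]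

/-- The matrix whose columns are the unit vectors indexed by the values of `f`. -/
def selection (𝕜 : Type*) {ι κ : Type*} [RCLike 𝕜] [DecidableEq ι] (f : κ → ι) : Matrix ι κ 𝕜 :=
  (1 : Matrix ι ι 𝕜).submatrix id f

theorem isContraction_selection {f : κ → ι} (hf : Function.Injective f) :
    IsContraction (selection 𝕜 f) := by
  refine isContraction_of_conjTranspose_mul_self ?_
  rw [selection, Matrix.conjTranspose_submatrix, Matrix.conjTranspose_one,
    ← Matrix.submatrix_mul _ _ f id f Function.bijective_id, one_mul, Matrix.submatrix_one f hf]

theorem submatrix_eq_mul_selection {ι' κ' : Type*} (M : Matrix ι κ 𝕜) (f : ι' → ι) (g : κ' → κ) :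
    M.submatrix f g = (selection 𝕜 f).conjTranspose * M * selection 𝕜 g := by
  rw [selection, selection, Matrix.conjTranspose_submatrix, Matrix.conjTranspose_one,
    ← Matrix.submatrix_id_id M, ← Matrix.submatrix_mul _ _ f id id Function.bijective_id,
    ← Matrix.submatrix_mul _ _ f id g Function.bijective_id]
  simp

theorem schattenNorm_submatrix_le (p : ℝ≥0∞) (hp : 1 ≤ p) {ι' κ' : Type*} [Fintype ι']
    [DecidableEq ι'] [Fintype κ'] [DecidableEq κ'] (M : Matrix ι κ 𝕜) {f : ι' → ι} {g : κ' → κ}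
    (hf : Function.Injective f) (hg : Function.Injective g) :
    schattenNorm p (M.submatrix f g) ≤ schattenNorm p M := by
  rw [submatrix_eq_mul_selection]
  exact schattenNorm_mul_mul_le p hp (isContraction_selection hf).conjTranspose M
    (isContraction_selection hg)

theorem schattenNorm_contraction_mul_le (p : ℝ≥0∞) (hp : 1 ≤ p) {U : Matrix ι ι 𝕜}
    (hU : IsContraction U) (M : Matrix ι κ 𝕜) : schattenNorm p (U * M) ≤ schattenNorm p M := by
  simpa using schattenNorm_mul_mul_le p hp hU M (isContraction_one (𝕜 := 𝕜) (ι := κ))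

theorem schattenNorm_mul_contraction_le (p : ℝ≥0∞) (hp : 1 ≤ p) {V : Matrix κ κ 𝕜}
    (hV : IsContraction V) (M : Matrix ι κ 𝕜) : schattenNorm p (M * V) ≤ schattenNorm p M := by
  simpa using schattenNorm_mul_mul_le p hp (isContraction_one (𝕜 := 𝕜) (ι := ι)) M hV

/-- The coordinate projections onto the blocks resolve the identity, so a matrix is the sum of its
block rows or columns padded by zeros. -/
theorem sum_selection_mul_conjTranspose {t : ℕ} (b : ι → Fin t) :
    ∑ i, selection 𝕜 (Subtype.val : {x // b x = i} → ι) *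
      (selection 𝕜 (Subtype.val : {x // b x = i} → ι)).conjTranspose = 1 := by
  ext x y
  simp only [Matrix.sum_apply, Matrix.mul_apply, selection, Matrix.conjTranspose_apply,
    Matrix.submatrix_apply]
  refine (Fintype.sum_fiberwise b
    (fun z => (1 : Matrix ι ι 𝕜) x z * star ((1 : Matrix ι ι 𝕜) y z))).trans ?_
  simp [Matrix.one_apply]

theorem schattenNorm_le_sum_rows (p : ℝ≥0∞) (hp : 1 ≤ p) {t : ℕ} (b : ι → Fin t)
    (B : Matrix ι κ 𝕜) :
    schattenNorm p B ≤ ∑ i, schattenNorm p (B.submatrix (Subtype.val : {x // b x = i} → ι) id) := by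
  have h : B = ∑ i, selection 𝕜 (Subtype.val : {x // b x = i} → ι) *
      B.submatrix (Subtype.val : {x // b x = i} → ι) id := by
    conv_lhs => rw [← Matrix.one_mul B, ← sum_selection_mul_conjTranspose b, Matrix.sum_mul]
    refine Finset.sum_congr rfl fun i _ => ?_
    rw [submatrix_eq_mul_selection, Matrix.mul_assoc, Matrix.mul_assoc]
    simp [selection]
  conv_lhs => rw [h]
  refine (schattenNorm_sum_le p hp _ _).trans (Finset.sum_le_sum fun i _ => ?_)
  simpa using schattenNorm_mul_mul_le p hp (isContraction_selection Subtype.val_injective)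
    (B.submatrix (Subtype.val : {x // b x = i} → ι) id) (isContraction_one (𝕜 := 𝕜) (ι := κ))

theorem schattenNorm_le_sum_columns (p : ℝ≥0∞) (hp : 1 ≤ p) {t : ℕ} (b : κ → Fin t)
    (B : Matrix ι κ 𝕜) :
    schattenNorm p B ≤ ∑ i, schattenNorm p (B.submatrix id (Subtype.val : {x // b x = i} → κ)) := by
  have h : B = ∑ i, B.submatrix id (Subtype.val : {x // b x = i} → κ) *
      (selection 𝕜 (Subtype.val : {x // b x = i} → κ)).conjTranspose := by
    conv_lhs => rw [← Matrix.mul_one B, ← sum_selection_mul_conjTranspose b, Matrix.mul_sum]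
    refine Finset.sum_congr rfl fun i _ => ?_
    rw [submatrix_eq_mul_selection, ← Matrix.mul_assoc]
    simp [selection]
  conv_lhs => rw [h]
  refine (schattenNorm_sum_le p hp _ _).trans (Finset.sum_le_sum fun i _ => ?_)
  simpa using schattenNorm_mul_mul_le p hp (isContraction_one (𝕜 := 𝕜) (ι := ι))
    (B.submatrix id (Subtype.val : {x // b x = i} → κ))
    (isContraction_selection Subtype.val_injective).conjTranspose

theorem schattenNorm_le_sum_blocks (p : ℝ≥0∞) (hp : 1 ≤ p) {t : ℕ} (b : ι → Fin t)
    (B : Matrix ι ι 𝕜) : schattenNorm p B ≤ ∑ i, ∑ j, schattenNorm p (block b B i j) :=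
  (schattenNorm_le_sum_rows p hp b B).trans
    (Finset.sum_le_sum fun _ _ => schattenNorm_le_sum_columns p hp b _)

theorem schattenNorm_block_le_blockMaxNorm (p : ℝ≥0∞) {t : ℕ} (b : ι → Fin t)
    (B : Matrix ι ι 𝕜) (i j : Fin t) : schattenNorm p (block b B i j) ≤ blockMaxNorm p b B :=
  le_ciSup (f := fun ij : Fin t × Fin t => schattenNorm p (block b B ij.1 ij.2))
    (Set.finite_range _).bddAbove (i, j)

theorem blockMaxNorm_nonneg (p : ℝ≥0∞) (hp : 1 ≤ p) {t : ℕ} (b : ι → Fin t)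
    (B : Matrix ι ι 𝕜) : 0 ≤ blockMaxNorm p b B :=
  Real.iSup_nonneg fun _ => schattenNorm_nonneg p hp _

theorem blockMaxNorm_zero (p : ℝ≥0∞) (hp : 1 ≤ p) {t : ℕ} (b : ι → Fin t) :
    blockMaxNorm p b (0 : Matrix ι ι 𝕜) = 0 :=
  le_antisymm (Real.iSup_le (fun _ => (schattenNorm_zero p hp).le) le_rfl)
    (blockMaxNorm_nonneg p hp b 0)

theorem eq_zero_of_blockMaxNorm_eq_zero (p : ℝ≥0∞) (hp : 1 ≤ p) {t : ℕ} {b : ι → Fin t}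
    {B : Matrix ι ι 𝕜} (h : blockMaxNorm p b B = 0) : B = 0 := by
  refine eq_zero_of_schattenNorm_eq_zero p hp (le_antisymm ?_ (schattenNorm_nonneg p hp B))
  refine (schattenNorm_le_sum_blocks p hp b B).trans
    (Finset.sum_nonpos fun i _ => Finset.sum_nonpos fun j _ => ?_)
  exact (schattenNorm_block_le_blockMaxNorm p b B i j).trans h.le

end Selection

/-! ### Schur complements in terms of the block LU factors -/

section Schur

variable {𝕜 : Type*} [RCLike 𝕜]

theorem toBlock_mul_add {ι : Type*} [Fintype ι] {P Q : ι → Prop} [DecidablePred P]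
    [DecidablePred Q] (hPQ : ∀ x, ¬ Q x ↔ P x) (r s : ι → Prop) (M N : Matrix ι ι 𝕜) :
    (M * N).toBlock r s = M.toBlock r Q * N.toBlock Q s + M.toBlock r P * N.toBlock P s := by
  obtain rfl : P = fun x => ¬ Q x := funext fun x => propext (hPQ x).symm
  ext x y
  simp only [Matrix.toBlock_apply, Matrix.mul_apply, Matrix.add_apply]
  rw [← Fintype.sum_subtype_add_sum_subtype Q (fun z => M x z * N z y)]
  congr 1
  refine Finset.sum_congr ?_ fun _ _ => rfl
  ext
  simp

variable {n : ℕ} {c : Composition n} {A L R : Matrix (Fin n) (Fin n) 𝕜}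

/-- det A = det L · det R, and each block triangular determinant splits off its leading part. -/
theorem IsBlockLU.isUnit_det_leading (h : IsBlockLU c A L R) (hA : IsUnit A.det)
    (k : Fin c.length) :
    IsUnit (L.toBlock (fun x => c.index x < k) (fun x => c.index x < k)).det ∧
    IsUnit (R.toBlock (fun x => c.index x < k) (fun x => c.index x < k)).det := by
  rw [h.eq_mul, Matrix.det_mul, IsUnit.mul_iff] at hA
  obtain ⟨hL, hR⟩ := hA
  rw [Matrix.twoBlockTriangular_det' L (fun x => c.index x < k)
    (fun i hi j hj => h.lower i j (hi.trans_le (not_lt.mp hj))), IsUnit.mul_iff] at hL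
  rw [Matrix.twoBlockTriangular_det R (fun x => c.index x < k)
    (fun i hi j hj => h.upper i j (hj.trans_le (not_lt.mp hi))), IsUnit.mul_iff] at hR
  exact ⟨hL.1, hR.1⟩

/-- With 1 for the eliminated and 2 for the trailing indices, A₂₂ = L₂₁R₁₂ + L₂₂R₂₂, while
A₂₁A₁₁⁻¹A₁₂ = L₂₁R₁₁(L₁₁R₁₁)⁻¹L₁₁R₁₂ = L₂₁R₁₂. -/
theorem IsBlockLU.schur_eq (h : IsBlockLU c A L R) (hA : IsUnit A.det) (k : Fin c.length) :
    schur c A k = L.toBlock (fun x => k ≤ c.index x) (fun x => k ≤ c.index x) *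
      R.toBlock (fun x => k ≤ c.index x) (fun x => k ≤ c.index x) := by
  obtain ⟨hL, hR⟩ := h.isUnit_det_leading hA k
  have hPQ : ∀ x, ¬ c.index x < k ↔ k ≤ c.index x := fun x => not_lt
  have hL0 : L.toBlock (fun x => c.index x < k) (fun x => k ≤ c.index x) = 0 := by
    ext x y
    exact h.lower _ _ (x.2.trans_le y.2)
  have hR0 : R.toBlock (fun x => k ≤ c.index x) (fun x => c.index x < k) = 0 := by
    ext x y
    exact h.upper _ _ (y.2.trans_le x.2)
  rw [schur, h.eq_mul]
  simp only [toBlock_mul_add hPQ, hL0, hR0, Matrix.zero_mul, Matrix.mul_zero, add_zero]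
  rw [Matrix.mul_inv_rev]
  simp only [← Matrix.mul_assoc]
  rw [Matrix.mul_assoc (L.toBlock _ _) (R.toBlock _ _) (R.toBlock _ _)⁻¹,
    Matrix.mul_nonsing_inv _ hR, Matrix.mul_one,
    Matrix.mul_assoc (L.toBlock _ _) (L.toBlock _ _)⁻¹ (L.toBlock _ _),
    Matrix.nonsing_inv_mul _ hL, Matrix.mul_one, add_sub_cancel_left]

theorem IsBlockLU.schur_apply_row (h : IsBlockLU c A L R) (hA : IsUnit A.det) (k : Fin c.length)
    (x y : Trailing c k) (hx : c.index x.1 = k) :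
    schur c A k x y = ∑ z : {z // c.index z = k}, L x z * R z y := by
  rw [h.schur_eq hA, Matrix.mul_apply]
  simp only [Matrix.toBlock_apply]
  rw [← Finset.sum_subtype (Finset.univ.filter fun z => k ≤ c.index z) (by simp)
      (fun z => L x z * R z y),
    ← Finset.sum_subtype (Finset.univ.filter fun z => c.index z = k) (by simp)
      (fun z => L x z * R z y)]
  symm
  refine Finset.sum_subset (fun z hz => ?_) (fun z hz hz' => ?_)
  · simp only [Finset.mem_filter, Finset.mem_univ, true_and] at hz ⊢
    exact hz.ge
  · simp only [Finset.mem_filter, Finset.mem_univ, true_and] at hz hz'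
    rw [h.lower _ _ (hx.trans_lt (lt_of_le_of_ne hz (Ne.symm hz'))), zero_mul]

theorem IsBlockLU.schur_apply_column (h : IsBlockLU c A L R) (hA : IsUnit A.det)
    (k : Fin c.length) (x y : Trailing c k) (hy : c.index y.1 = k) :
    schur c A k x y = ∑ z : {z // c.index z = k}, L x z * R z y := by
  rw [h.schur_eq hA, Matrix.mul_apply]
  simp only [Matrix.toBlock_apply]
  rw [← Finset.sum_subtype (Finset.univ.filter fun z => k ≤ c.index z) (by simp)
      (fun z => L x z * R z y),
    ← Finset.sum_subtype (Finset.univ.filter fun z => c.index z = k) (by simp)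
      (fun z => L x z * R z y)]
  symm
  refine Finset.sum_subset (fun z hz => ?_) (fun z hz hz' => ?_)
  · simp only [Finset.mem_filter, Finset.mem_univ, true_and] at hz ⊢
    exact hz.ge
  · simp only [Finset.mem_filter, Finset.mem_univ, true_and] at hz hz'
    rw [h.upper _ _ (hy.trans_lt (lt_of_le_of_ne hz (Ne.symm hz'))), mul_zero]

/-- The indices in block `i`, seen as trailing indices. -/
def trailingBlockEquiv (c : Composition n) {k i : Fin c.length} (hki : k ≤ i) :
    {x // c.index x = i} ≃ {x : Trailing c k // trailingIndex c k x = i} where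
  toFun x := ⟨⟨x.1, hki.trans_eq x.2.symm⟩, x.2⟩
  invFun x := ⟨x.1.1, x.2⟩
  left_inv _ := rfl
  right_inv _ := rfl

theorem IsBlockLU.schurBlock_row (h : IsBlockLU c A L R) (hA : IsUnit A.det)
    {k j : Fin c.length} (hkj : k ≤ j) :
    (schurBlock c A k k j).submatrix (trailingBlockEquiv c le_rfl) (trailingBlockEquiv c hkj) =
      block c.index L k k * block c.index R k j := by
  ext x y
  exact h.schur_apply_row hA k _ _ x.2

theorem IsBlockLU.schurBlock_column (h : IsBlockLU c A L R) (hA : IsUnit A.det)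
    {k i : Fin c.length} (hki : k ≤ i) :
    (schurBlock c A k i k).submatrix (trailingBlockEquiv c hki) (trailingBlockEquiv c le_rfl) =
      block c.index L i k * block c.index R k k := by
  ext x y
  exact h.schur_apply_column hA k _ _ y.2

theorem IsBlockLU.isUnit_det_block (h : IsBlockLU c A L R) (hA : IsUnit A.det)
    (k : Fin c.length) : IsUnit (block c.index R k k).det := by
  rw [h.eq_mul, Matrix.det_mul, IsUnit.mul_iff,
    Matrix.BlockTriangular.det_fintype (M := R) (b := c.index) (fun i j => h.upper i j),
    isUnit_iff_ne_zero (a := ∏ _, _), Finset.prod_ne_zero_iff] at hA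
  exact isUnit_iff_ne_zero.mpr (hA.2 k (Finset.mem_univ k))

theorem IsBlockLU.block_lower_eq (h : IsBlockLU c A L R) (hA : IsUnit A.det)
    (hL : ∀ k : Fin c.length,
      block c.index L k k ∈ Matrix.unitaryGroup {x // c.index x = k} 𝕜)
    {k i : Fin c.length} (hki : k ≤ i) :
    block c.index L i k = (schurBlock c A k i k * (schurBlock c A k k k)⁻¹).submatrix
      (trailingBlockEquiv c hki) (trailingBlockEquiv c le_rfl) * block c.index L k k := by
  have hLu : (block c.index L k k)⁻¹ * block c.index L k k = 1 := by
    rw [Matrix.inv_eq_left_inv (Matrix.mem_unitaryGroup_iff'.mp (hL k))]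
    exact Matrix.mem_unitaryGroup_iff'.mp (hL k)
  rw [← Matrix.submatrix_mul_equiv _ _ _ (trailingBlockEquiv c le_rfl), ← Matrix.inv_submatrix_equiv,
    h.schurBlock_column hA, h.schurBlock_column hA, Matrix.mul_inv_rev, Matrix.mul_assoc,
    Matrix.mul_assoc, Matrix.mul_assoc, hLu, Matrix.mul_one,
    Matrix.mul_nonsing_inv _ (h.isUnit_det_block hA k), Matrix.mul_one]

theorem IsBlockLU.block_upper_eq (h : IsBlockLU c A L R) (hA : IsUnit A.det)
    (hL : ∀ k : Fin c.length,
      block c.index L k k ∈ Matrix.unitaryGroup {x // c.index x = k} 𝕜)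
    {k j : Fin c.length} (hkj : k ≤ j) :
    block c.index R k j = (block c.index L k k).conjTranspose * (schurBlock c A k k j).submatrix
      (trailingBlockEquiv c le_rfl) (trailingBlockEquiv c hkj) := by
  rw [h.schurBlock_row hA, ← Matrix.mul_assoc, ← Matrix.star_eq_conjTranspose,
    Matrix.mem_unitaryGroup_iff'.mp (hL k), Matrix.one_mul]

/-- Columns of this block row before block k vanish, so it is a zero-padded row of the Schur
complement. Bounding the whole row at once costs a single factor n_t for `R`, where a blockwise sum
would cost n_t². -/
theorem IsBlockLU.row_upper_eq (h : IsBlockLU c A L R) (hA : IsUnit A.det)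
    (hL : ∀ k : Fin c.length,
      block c.index L k k ∈ Matrix.unitaryGroup {x // c.index x = k} 𝕜) (k : Fin c.length) :
    R.submatrix (Subtype.val : {x // c.index x = k} → Fin n) id =
      (block c.index L k k).conjTranspose *
        (schur c A k).submatrix (fun x : {x // c.index x = k} => ⟨x.1, x.2.ge⟩) id *
        (selection 𝕜 (Subtype.val : Trailing c k → Fin n)).conjTranspose := by
  have h1 : (schur c A k).submatrix (fun x : {x // c.index x = k} => ⟨x.1, x.2.ge⟩) id =
      block c.index L k k *
        R.submatrix (Subtype.val : {x // c.index x = k} → Fin n)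
          (Subtype.val : Trailing c k → Fin n) := by
    ext x y
    exact h.schur_apply_row hA k _ _ x.2
  rw [h1, ← Matrix.mul_assoc, ← Matrix.star_eq_conjTranspose (block c.index L k k),
    Matrix.mem_unitaryGroup_iff'.mp (hL k), Matrix.one_mul]
  ext x y
  simp only [Matrix.mul_apply, Matrix.submatrix_apply, id, Matrix.conjTranspose_apply, selection]
  refine Eq.trans ?_ (Finset.sum_subtype (Finset.univ.filter fun z => k ≤ c.index z) (by simp)
    (fun z => R x z * star ((1 : Matrix (Fin n) (Fin n) 𝕜) y z)))
  rw [Finset.sum_filter_of_ne]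
  · simp [Matrix.one_apply]
  · intro z _ hz
    by_contra hlt
    rw [h.upper _ _ ((not_le.mp hlt).trans_eq x.2.symm), zero_mul] at hz
    exact hz rfl

end Schur

/-! ### Norm bounds for the two factors -/

section Bounds

variable {𝕜 : Type*} [RCLike 𝕜] {n : ℕ} {c : Composition n} {A L R : Matrix (Fin n) (Fin n) 𝕜}

theorem card_block_le_maxBlockSize (c : Composition n) (k : Fin c.length) :
    Fintype.card {x // c.index x = k} ≤ maxBlockSize c := by
  have h : Fintype.card {x // c.index x = k} = c.blocksFun k := by
    rw [← Fintype.card_fin (c.blocksFun k)]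
    refine (Fintype.card_congr (Equiv.ofBijective
      (fun y : Fin (c.blocksFun k) => ⟨c.embedding k y, c.index_embedding k y⟩) ⟨?_, ?_⟩)).symm
    · intro y z hyz
      exact (c.embedding k).injective (congrArg Subtype.val hyz)
    · rintro ⟨x, rfl⟩
      exact ⟨c.invEmbedding x, Subtype.ext (c.embedding_comp_inv x)⟩
  rw [h]
  exact Finset.le_sup (f := c.blocksFun) (Finset.mem_univ k)

theorem one_le_maxBlockSize (c : Composition n) (k : Fin c.length) : 1 ≤ maxBlockSize c :=
  (c.one_le_blocksFun k).trans (Finset.le_sup (f := c.blocksFun) (Finset.mem_univ k))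

theorem IsBlockLU.schattenNorm_block_lower_le (p : ℝ≥0∞) (hp : 1 ≤ p) (h : IsBlockLU c A L R)
    (hA : IsUnit A.det)
    (hL : ∀ k : Fin c.length,
      block c.index L k k ∈ Matrix.unitaryGroup {x // c.index x = k} 𝕜)
    (hpp : ∀ k i : Fin c.length, k < i →
      schattenNorm p (schurBlock c A k i k * (schurBlock c A k k k)⁻¹) ≤ 1)
    (i j : Fin c.length) :
    schattenNorm p (block c.index L i j) ≤ (maxBlockSize c : ℝ) ^ (1 / p).toReal := by
  rcases lt_trichotomy i j with hij | rfl | hij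
  · have : block c.index L i j = 0 := by
      ext x y
      exact h.lower _ _ (by rw [x.2, y.2]; exact hij)
    rw [this, schattenNorm_zero p hp]
    positivity
  · refine (schattenNorm_le_of_isContraction p hp (isContraction_unitary (hL i))).trans ?_
    gcongr
    exact card_block_le_maxBlockSize c i
  · calc schattenNorm p (block c.index L i j) ≤ 1 := by
          rw [h.block_lower_eq hA hL hij.le]
          exact ((schattenNorm_mul_contraction_le p hp (isContraction_unitary (hL j)) _).trans
            (schattenNorm_submatrix_le p hp _ (Equiv.injective _) (Equiv.injective _))).trans
            (hpp j i hij)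
      _ ≤ _ := Real.one_le_rpow (by exact_mod_cast one_le_maxBlockSize c i) (by positivity)

theorem IsBlockLU.blockMaxNorm_upper_le (p : ℝ≥0∞) (hp : 1 ≤ p) (h : IsBlockLU c A L R)
    (hA : IsUnit A.det)
    (hL : ∀ k : Fin c.length,
      block c.index L k k ∈ Matrix.unitaryGroup {x // c.index x = k} 𝕜) :
    blockMaxNorm p c.index R ≤
      ⨆ k : Fin c.length, blockMaxNorm p (trailingIndex c k) (schur c A k) := by
  refine Real.iSup_le (fun ij => ?_) (Real.iSup_nonneg fun _ => blockMaxNorm_nonneg p hp _ _)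
  obtain ⟨i, j⟩ := ij
  dsimp only
  rcases lt_or_ge j i with hij | hij
  · have : block c.index R i j = 0 := by
      ext x y
      exact h.upper _ _ (by rw [x.2, y.2]; exact hij)
    rw [this, schattenNorm_zero p hp]
    exact Real.iSup_nonneg fun _ => blockMaxNorm_nonneg p hp _ _
  · rw [h.block_upper_eq hA hL hij]
    refine (schattenNorm_contraction_mul_le p hp (isContraction_unitary (hL i)).conjTranspose _).trans
      ((schattenNorm_submatrix_le p hp _ (Equiv.injective _) (Equiv.injective _)).trans ?_)
    exact (schattenNorm_block_le_blockMaxNorm p (trailingIndex c i) (schur c A i) i j).trans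
      (le_ciSup (f := fun k : Fin c.length => blockMaxNorm p (trailingIndex c k) (schur c A k))
        (Set.finite_range _).bddAbove i)

theorem IsBlockLU.schattenNorm_upper_le (p : ℝ≥0∞) (hp : 1 ≤ p) (h : IsBlockLU c A L R)
    (hA : IsUnit A.det)
    (hL : ∀ k : Fin c.length,
      block c.index L k k ∈ Matrix.unitaryGroup {x // c.index x = k} 𝕜) :
    schattenNorm p R ≤ c.length * ⨆ k : Fin c.length, schattenNorm p (schur c A k) := by
  calc schattenNorm p R
      ≤ ∑ k, schattenNorm p (R.submatrix (Subtype.val : {x // c.index x = k} → Fin n) id) :=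
        schattenNorm_le_sum_rows p hp c.index R
    _ ≤ ∑ _k : Fin c.length, ⨆ k : Fin c.length, schattenNorm p (schur c A k) := by
        refine Finset.sum_le_sum fun k _ => ?_
        rw [h.row_upper_eq hA hL k]
        refine (schattenNorm_mul_mul_le p hp (isContraction_unitary (hL k)).conjTranspose _
          (isContraction_selection Subtype.val_injective).conjTranspose).trans ?_
        refine (schattenNorm_submatrix_le p hp _ (fun x y hxy => ?_) Function.injective_id).trans
          (le_ciSup (f := fun k : Fin c.length => schattenNorm p (schur c A k))
            (Set.finite_range _).bddAbove k)
        exact Subtype.ext (congrArg (fun z : Trailing c k => z.1) hxy)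
    _ = _ := by simp

theorem StronglyNonsingular.isUnit_det (hA : StronglyNonsingular A) : IsUnit A.det := by
  simpa using hA n le_rfl

/-- Covers a vanishing denominator in a growth factor: a nonsingular zero matrix forces n = 0. -/
theorem eq_zero_of_isUnit_det_zero (h : IsUnit (0 : Matrix (Fin n) (Fin n) 𝕜).det)
    (M : Matrix (Fin n) (Fin n) 𝕜) : M = 0 := by
  rcases isEmpty_or_nonempty (Fin n) with h0 | h0
  · exact Subsingleton.elim _ _
  · simp [Matrix.det_zero] at h

end Bounds

end BlockLU


theorem mainTheorem7 {𝕜 : Type*} [RCLike 𝕜] {n : ℕ} (p : ℝ≥0∞) (hp : 1 ≤ p)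
    (c : Composition n) (A L R : Matrix (Fin n) (Fin n) 𝕜)
    (hA : BlockLU.StronglyNonsingular A)
    (hLR : BlockLU.IsBlockLU c A L R)
    (hL : ∀ k : Fin c.length,
      BlockLU.block c.index L k k ∈ Matrix.unitaryGroup {x // c.index x = k} 𝕜)
    (hpp : ∀ k i : Fin c.length, k < i →
      BlockLU.schattenNorm p
        (BlockLU.schurBlock c A k i k * (BlockLU.schurBlock c A k k k)⁻¹) ≤ 1) :
    BlockLU.blockMaxNorm p c.index L ≤ (BlockLU.maxBlockSize c : ℝ) ^ (1 / p).toReal ∧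
    BlockLU.schattenNorm p L ≤
      (BlockLU.maxBlockSize c : ℝ) ^ (1 / p).toReal * (c.length : ℝ) ^ 2 ∧
    BlockLU.blockMaxNorm p c.index L * BlockLU.blockMaxNorm p c.index R ≤
      (BlockLU.maxBlockSize c : ℝ) ^ (1 / p).toReal * BlockLU.growthMax p c A *
        BlockLU.blockMaxNorm p c.index A ∧
    BlockLU.schattenNorm p L * BlockLU.schattenNorm p R ≤
      (BlockLU.maxBlockSize c : ℝ) ^ (1 / p).toReal * (c.length : ℝ) ^ 3 *
        BlockLU.growth p c A * BlockLU.schattenNorm p A := by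
  have hA' := hA.isUnit_det
  have hLb := hLR.schattenNorm_block_lower_le p hp hA' hL hpp
  have hLmax : BlockLU.blockMaxNorm p c.index L ≤
      (BlockLU.maxBlockSize c : ℝ) ^ (1 / p).toReal :=
    Real.iSup_le (fun ij => hLb ij.1 ij.2) (by positivity)
  have hLp : BlockLU.schattenNorm p L ≤
      (BlockLU.maxBlockSize c : ℝ) ^ (1 / p).toReal * (c.length : ℝ) ^ 2 := by
    refine (BlockLU.schattenNorm_le_sum_blocks p hp c.index L).trans
      ((Finset.sum_le_sum fun i _ => Finset.sum_le_sum fun j _ => hLb i j).trans_eq ?_)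
    simp only [Finset.sum_const, Finset.card_univ, Fintype.card_fin, nsmul_eq_mul]
    ring
  refine ⟨hLmax, hLp, ?_, ?_⟩
  -- Cancelling ‖A‖ against the denominator of the growth factor needs ‖A‖ ≠ 0; otherwise n = 0 and
  -- both sides are 0.
  · by_cases h0 : BlockLU.blockMaxNorm p c.index A = 0
    · rw [BlockLU.eq_zero_of_blockMaxNorm_eq_zero p hp h0] at hA'
      rw [h0, BlockLU.eq_zero_of_isUnit_det_zero hA' R, BlockLU.blockMaxNorm_zero p hp]
      simp
    · rw [BlockLU.growthMax, mul_assoc, div_mul_cancel₀ _ h0]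
      exact mul_le_mul hLmax (hLR.blockMaxNorm_upper_le p hp hA' hL)
        (BlockLU.blockMaxNorm_nonneg p hp _ _) (by positivity)
  · by_cases h0 : BlockLU.schattenNorm p A = 0
    · rw [BlockLU.eq_zero_of_schattenNorm_eq_zero p hp h0] at hA'
      rw [h0, BlockLU.eq_zero_of_isUnit_det_zero hA' R, BlockLU.schattenNorm_zero p hp]
      simp
    · rw [BlockLU.growth, mul_assoc, div_mul_cancel₀ _ h0]
      refine (mul_le_mul hLp (hLR.schattenNorm_upper_le p hp hA' hL)
        (BlockLU.schattenNorm_nonneg p hp _) (by positivity)).trans_eq ?_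
      ring
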